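/- Let $\ell_\infty$ be the complex Banach space of bounded complex sequences with the supremum norm, and let $P:\ell_\infty\to\mathbb{C}$ be a non-zero continuous $2$-homogeneous polynomial, that is, $P(x)=A(x,x)$ for a symmetric bilinear form $A:\ell_\infty\times\ell_\infty\to\mathbb{C}$, and there is a constant $k$ with $|P(x)|\le k\|x\|^2$ for all $x$. Then there is a non-separable $P$-maximal subspace $M$ of $\ell_\infty$. Here a proper complex linear subspace $M\subsetneq \ell_\infty$ is called $P$-maximal if $P|_M=0$ and every linear subspace $M_1$ of $\ell_\infty$ with $M\subset M_1$ and $P|_{M_1}=0$ is equal to $M$. -/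

import Mathlib

open scoped ENNReal

/-- `P : X → 𝕜` is a continuous `n`-homogeneous polynomial: it is the restriction to the diagonal
of a symmetric `n`-linear form, and `|P x| ≤ k ‖x‖ ^ n` for some constant `k`. -/
def IsContHomogeneousPolynomial {𝕜 X : Type*} [RCLike 𝕜] [NormedAddCommGroup X] [NormedSpace 𝕜 X]
    (n : ℕ) (P : X → 𝕜) : Prop :=
  (∃ A : MultilinearMap 𝕜 (fun _ : Fin n => X) 𝕜,
    (∀ (σ : Equiv.Perm (Fin n)) (v : Fin n → X), A (fun i => v (σ i)) = A v) ∧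
    ∀ x : X, P x = A (fun _ => x)) ∧
  ∃ k : ℝ, ∀ x : X, ‖P x‖ ≤ k * ‖x‖ ^ n

/-- A linear subspace `M` of `X` is `P`-maximal: it is proper, `P` vanishes on it, and every
linear subspace that contains `M` and on which `P` vanishes is equal to `M`. -/
def IsPMaximal {𝕜 X : Type*} [RCLike 𝕜] [NormedAddCommGroup X] [NormedSpace 𝕜 X]
    (P : X → 𝕜) (M : Submodule 𝕜 X) : Prop :=
  M ≠ ⊤ ∧ (∀ x ∈ M, P x = 0) ∧
    ∀ M₁ : Submodule 𝕜 X, (∀ x ∈ M₁, P x = 0) → M ≤ M₁ → M₁ = M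

/-!
Let `P x = B x x` with `B` symmetric and separately continuous, and let `eₙ` be the unit vectors of
`ℓ∞`. Over `ℂ` every plane contains an isotropic line, so finitely many linear conditions on a large
enough finite-dimensional space leave an isotropic vector. Inductively this gives unit vectors of
`ℓ∞` with disjoint supports that span a totally isotropic subspace, hence an isometry `J` of `ℓ∞`
such that all `J eₙ` lie in some maximal totally isotropic `M`.

If `M` were separable, with a dense sequence `dᵢ`, the functionals `B dᵢ ∘ J` would vanish at every
`eₙ`. Such a functional vanishes at the indicators of all but countably many members of an almost
disjoint family, so by taking a family of cardinality continuum one sees that the common kernel of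
countably many of them is not separable. But `J` maps this kernel into `Mᗮ`, and by maximality
`Mᗮ` exceeds `M` by at most one dimension.
-/

open Function TopologicalSpace

section Isotropic

variable {K X : Type*} [Field K] [AddCommGroup X] [Module K X] {B : LinearMap.BilinForm K X}

/-- A subspace `M` is totally isotropic for `B` if the quadratic form `x ↦ B x x` vanishes on `M`.
For `P x = B x x` the `P`-maximal subspaces are the proper maximal totally isotropic ones. -/
def IsTotallyIsotropic (B : LinearMap.BilinForm K X) (M : Submodule K X) : Prop :=
  ∀ x ∈ M, B x x = 0

theorem exists_isotropic_smul_add_smul [IsAlgClosed K] [NeZero (2 : K)]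
    (B : LinearMap.BilinForm K X) (u v : X) :
    ∃ a b : K, (a ≠ 0 ∨ b ≠ 0) ∧ B (a • u + b • v) (a • u + b • v) = 0 := by
  by_cases hu : B u u = 0
  · exact ⟨1, 0, Or.inl one_ne_zero, by simp [hu]⟩
  · obtain ⟨a, ha⟩ := exists_quadratic_eq_zero (b := B u v + B v u) (c := B v v) hu
      (IsAlgClosed.exists_eq_mul_self _)
    refine ⟨a, 1, Or.inr one_ne_zero, ?_⟩
    simp only [map_add, map_smul, LinearMap.add_apply, LinearMap.smul_apply, smul_eq_mul]
    linear_combination ha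

theorem one_lt_finrank_ker {V W : Type*} [AddCommGroup V] [Module K V] [AddCommGroup W] [Module K W]
    [FiniteDimensional K V] [FiniteDimensional K W] (L : V →ₗ[K] W)
    (h : Module.finrank K W + 1 < Module.finrank K V) :
    1 < Module.finrank K (LinearMap.ker L) := by
  have := L.finrank_range_add_finrank_ker
  have := (LinearMap.range L).finrank_le
  omega

theorem exists_isotropic_mem_of_card_lt_finrank [IsAlgClosed K] [NeZero (2 : K)]
    (B : LinearMap.BilinForm K X) (s : Finset X) (V : Submodule K X)
    (hV : s.card + 1 < Module.finrank K V) :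
    ∃ v ∈ V, v ≠ 0 ∧ B v v = 0 ∧ ∀ x ∈ s, B x v = 0 := by
  have : FiniteDimensional K V := Module.finite_of_finrank_pos (by omega)
  let L : V →ₗ[K] (s → K) := LinearMap.pi fun x => (B x).comp V.subtype
  have hker : 1 < Module.finrank K (LinearMap.ker L) := one_lt_finrank_ker L (by simpa using hV)
  have : Nontrivial (LinearMap.ker L) := Module.nontrivial_of_finrank_pos (R := K) (by omega)
  obtain ⟨u, hu⟩ := exists_ne (0 : LinearMap.ker L)
  obtain ⟨v, huv⟩ := exists_linearIndependent_pair_of_one_lt_finrank hker hu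
  obtain ⟨a, b, hab, hiso⟩ := exists_isotropic_smul_add_smul B (u : V) (v : V)
  set w : LinearMap.ker L := a • u + b • v
  refine ⟨(w : V), (w : V).2, fun hw => ?_, hiso, fun x hx => congrFun w.2 ⟨x, hx⟩⟩
  have := LinearIndependent.pair_iff.1 huv a b (Subtype.ext (Subtype.ext hw))
  tauto

namespace IsTotallyIsotropic

theorem span {s : Set X} (hs : ∀ x ∈ s, ∀ y ∈ s, B x y = 0) :
    IsTotallyIsotropic B (Submodule.span K s) := fun x hx =>
  LinearMap.BilinMap.apply_apply_mem_of_mem_span ⊥ s s B hs x x hx hx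

theorem exists_le_maximal {M : Submodule K X} (hM : IsTotallyIsotropic B M) :
    ∃ N, M ≤ N ∧ Maximal (IsTotallyIsotropic B) N := by
  refine zorn_le_nonempty₀ {N | IsTotallyIsotropic B N} (fun c hc hchain N hN => ?_) M hM
  refine ⟨sSup c, fun x hx => ?_, fun _ => le_sSup⟩
  obtain ⟨N', hN', hx'⟩ := (Submodule.mem_sSup_of_directed ⟨N, hN⟩ hchain.directedOn).1 hx
  exact hc hN' x hx'

variable {M : Submodule K X}

theorem apply_eq_zero [NeZero (2 : K)] (hM : IsTotallyIsotropic B M) (hB : B.IsSymm) {x y : X}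
    (hx : x ∈ M) (hy : y ∈ M) : B x y = 0 := by
  have h := hM _ (M.add_mem hx hy)
  simp only [map_add, LinearMap.add_apply, hM x hx, hM y hy, hB.eq y x, zero_add, add_zero,
    ← two_mul] at h
  exact (mul_eq_zero.1 h).resolve_left two_ne_zero

theorem sup_span_singleton (hM : IsTotallyIsotropic B M) (hB : B.IsSymm) {w : X}
    (hw : w ∈ B.orthogonal M) (hww : B w w = 0) :
    IsTotallyIsotropic B (M ⊔ Submodule.span K {w}) := by
  intro x hx
  obtain ⟨m, hm, z, hz, rfl⟩ := Submodule.mem_sup.1 hx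
  obtain ⟨c, rfl⟩ := Submodule.mem_span_singleton.1 hz
  have hmw : B m w = 0 := hw m hm
  simp [hM m hm, hmw, hww, hB.eq w m]

theorem mem_of_maximal (hM : Maximal (IsTotallyIsotropic B) M) (hB : B.IsSymm) {w : X}
    (hw : w ∈ B.orthogonal M) (hww : B w w = 0) : w ∈ M :=
  hM.le_of_ge (hM.prop.sup_span_singleton hB hw hww) le_sup_left
    (Submodule.mem_sup_right (Submodule.mem_span_singleton_self w))

theorem exists_orthogonal_le_sup_span [IsAlgClosed K] [NeZero (2 : K)]
    (hM : Maximal (IsTotallyIsotropic B) M) (hB : B.IsSymm) :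
    ∃ u, B.orthogonal M ≤ M ⊔ Submodule.span K {u} := by
  by_cases h : B.orthogonal M ≤ M
  · exact ⟨0, h.trans le_sup_left⟩
  obtain ⟨u, hu, huM⟩ := SetLike.not_le_iff_exists.1 h
  refine ⟨u, fun v hv => ?_⟩
  obtain ⟨a, b, hab, hiso⟩ := exists_isotropic_smul_add_smul B u v
  have hmem : a • u + b • v ∈ M :=
    mem_of_maximal hM hB (add_mem (Submodule.smul_mem _ a hu) (Submodule.smul_mem _ b hv)) hiso
  have hb : b ≠ 0 := by
    rintro rfl
    have ha : a ≠ 0 := by simpa using hab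
    exact huM ((M.smul_mem_iff ha).1 (by simpa using hmem))
  refine (Submodule.smul_mem_iff _ hb).1 ?_
  rw [← add_sub_cancel_left (a • u) (b • v), sub_eq_add_neg, ← neg_smul]
  exact Submodule.add_mem_sup hmem
    (Submodule.smul_mem _ _ (Submodule.mem_span_singleton_self u))

end IsTotallyIsotropic

end Isotropic

theorem isSeparable_orthogonal_of_maximal {X : Type*} [NormedAddCommGroup X] [NormedSpace ℂ X]
    {B : LinearMap.BilinForm ℂ X} (hB : B.IsSymm) {M : Submodule ℂ X}
    (hM : Maximal (IsTotallyIsotropic B) M) (hsep : IsSeparable (M : Set X)) :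
    IsSeparable (B.orthogonal M : Set X) := by
  obtain ⟨u, hu⟩ := IsTotallyIsotropic.exists_orthogonal_le_sup_span hM hB
  have h := (hsep.union (Set.countable_singleton u).isSeparable).span (R := ℂ)
  rw [Submodule.span_union, Submodule.span_eq] at h
  exact h.mono hu

section Polarization

theorem exists_bilinForm_apply_eq_multilinearMap {R X : Type*} [CommSemiring R] [AddCommMonoid X]
    [Module R X] (A : MultilinearMap R (fun _ : Fin 2 => X) R) :
    ∃ B : LinearMap.BilinForm R X, ∀ x y, B x y = A ![x, y] := by
  refine ⟨(MultilinearMap.ofSubsingletonₗ R R X R (0 : Fin 1)).symm.toLinearMap ∘ₗ A.curryLeft,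
    fun x y => congrArg A ?_⟩
  ext i
  fin_cases i <;> rfl

variable {𝕜 X : Type*} [RCLike 𝕜] [NormedAddCommGroup X] [NormedSpace 𝕜 X]

theorem continuous_bilinForm_of_norm_apply_self_le {B : LinearMap.BilinForm 𝕜 X} (hB : B.IsSymm)
    {k : ℝ} (hk : ∀ x, ‖B x x‖ ≤ k * ‖x‖ ^ 2) (x : X) : Continuous (B x) := by
  have polarization (y : X) : B x y = (B (x + y) (x + y) - B (x - y) (x - y)) / 4 := by
    simp only [map_add, map_sub, LinearMap.add_apply, LinearMap.sub_apply, hB.eq y x]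
    ring
  set C : ℝ := |k| * (‖x‖ + 1) ^ 2
  have quadratic_le {z : X} (hz : ‖z‖ ≤ ‖x‖ + 1) : ‖B z z‖ ≤ C :=
    (hk z).trans (mul_le_mul (le_abs_self k) (pow_le_pow_left₀ (norm_nonneg z) hz 2)
      (sq_nonneg _) (abs_nonneg k))
  have ball_le : ∀ y ∈ Metric.closedBall (0 : X) 1, ‖B x y‖ ≤ (C + C) / 4 := by
    intro y hy
    rw [mem_closedBall_zero_iff] at hy
    rw [polarization, norm_div, RCLike.norm_ofNat]
    gcongr
    refine (norm_sub_le _ _).trans (add_le_add (quadratic_le ?_) (quadratic_le ?_))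
    · exact (norm_add_le x y).trans (by gcongr)
    · exact (norm_sub_le x y).trans (by gcongr)
  exact AddMonoidHomClass.continuous_of_bound (B x) _
    (LinearMap.bound_of_ball_bound' one_pos _ (B x) ball_le)

theorem IsContHomogeneousPolynomial.exists_bilinForm {P : X → 𝕜}
    (hP : IsContHomogeneousPolynomial (𝕜 := 𝕜) 2 P) :
    ∃ B : LinearMap.BilinForm 𝕜 X, B.IsSymm ∧ (∀ x, Continuous (B x)) ∧ ∀ x, P x = B x x := by
  obtain ⟨⟨A, hsymm, hPA⟩, k, hk⟩ := hP
  obtain ⟨B, hBA⟩ := exists_bilinForm_apply_eq_multilinearMap A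
  have hB : B.IsSymm := ⟨fun x y => by
    rw [hBA, hBA, ← hsymm (Equiv.swap 0 1) ![y, x]]
    congr 1
    ext i
    fin_cases i <;> simp⟩
  have hPB (x : X) : P x = B x x := by
    rw [hPA, hBA]
    congr 1
    ext i
    fin_cases i <;> rfl
  exact ⟨B, hB, continuous_bilinForm_of_norm_apply_self_le hB fun x => hPB x ▸ hk x, hPB⟩

end Polarization

section AlmostDisjoint

-- The family consists of the branches of the full binary tree, whose nodes are coded by naturals.
theorem exists_almost_disjoint_family :
    ∃ S : (ℕ → Bool) → Set ℕ, Injective S ∧ Pairwise fun g h => (S g ∩ S h).Finite := by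
  let node (g : ℕ → Bool) (n : ℕ) : ℕ := Encodable.encode (PiNat.res g n)
  have node_eq {g h : ℕ → Bool} {m n : ℕ} (e : node g m = node h n) :
      m = n ∧ PiNat.res g m = PiNat.res h m := by
    have hres : PiNat.res g m = PiNat.res h n := Encodable.encode_injective e
    obtain rfl : m = n := by simpa using congrArg List.length hres
    exact ⟨rfl, hres⟩
  have finite_inter : Pairwise fun g h => (Set.range (node g) ∩ Set.range (node h)).Finite := by
    intro g h hgh
    obtain ⟨k, hk⟩ := Function.ne_iff.1 hgh
    refine ((Set.finite_Iic k).image (node g)).subset ?_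
    rintro _ ⟨⟨m, rfl⟩, n, hn⟩
    refine ⟨m, Set.mem_Iic.2 (not_lt.1 fun hkm => hk ?_), rfl⟩
    exact PiNat.res_eq_res.1 (node_eq hn.symm).2 hkm
  refine ⟨fun g => Set.range (node g),
    fun g h (hgh : Set.range (node g) = Set.range (node h)) => ?_, finite_inter⟩
  by_contra hne
  have hfin : (Set.range (node g) ∩ Set.range (node h)).Finite := finite_inter hne
  rw [← hgh, Set.inter_self] at hfin
  exact Set.infinite_range_of_injective (fun _ _ e => (node_eq e).1) hfin

theorem countable_of_isSeparable_of_pairwise_le_dist {X ι : Type*} [MetricSpace X] {s : Set X}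
    (hs : IsSeparable s) (y : ι → X) (hy : ∀ i, y i ∈ s) {ε : ℝ} (hε : 0 < ε)
    (hdist : Pairwise fun i j => ε ≤ dist (y i) (y j)) : Countable ι := by
  have : SeparableSpace (Set.range y) :=
    (hs.mono (Set.range_subset_iff.2 hy)).separableSpace
  have : DiscreteTopology (Set.range y) := by
    refine .of_forall_le_dist hε ?_
    rintro ⟨_, i, rfl⟩ ⟨_, j, rfl⟩ hij
    exact hdist fun h => hij (by rw [h])
  have : Countable (Set.range y) := separableSpace_iff_countable.1 inferInstance
  have hinj : Injective y := fun i j hij => by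
    by_contra hne
    have hle : ε ≤ dist (y i) (y j) := hdist hne
    rw [hij, dist_self] at hle
    exact hle.not_gt hε
  exact (Set.rangeFactorization_injective.2 hinj).countable

end AlmostDisjoint

section Indicator

variable {α 𝕜 ι : Type*} [RCLike 𝕜]

open Classical in
variable (𝕜) in
/-- The indicator function of `S`, as an element of the space of bounded functions. -/
noncomputable def lpIndicator (S : Set α) : lp (fun _ : α => 𝕜) ∞ :=
  ⟨fun k => if k ∈ S then 1 else 0,
    memℓp_infty ⟨1, by rintro _ ⟨k, rfl⟩; dsimp only; split_ifs <;> simp⟩⟩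

open Classical in
@[simp]
theorem lpIndicator_apply (S : Set α) (k : α) : lpIndicator 𝕜 S k = if k ∈ S then 1 else 0 := rfl

theorem one_le_dist_lpIndicator {S T : Set α} (hST : S ≠ T) :
    1 ≤ dist (lpIndicator 𝕜 S) (lpIndicator 𝕜 T) := by
  obtain ⟨k, hk⟩ : ∃ k, ¬(k ∈ S ↔ k ∈ T) := by
    by_contra! h
    exact hST (Set.ext h)
  rw [dist_eq_norm]
  refine le_trans ?_ (lp.norm_apply_le_norm ENNReal.top_ne_zero _ k)
  by_cases hS : k ∈ S <;> by_cases hT : k ∈ T <;> simp_all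

theorem norm_sum_smul_lpIndicator_le_one {t : Finset ι} {S : ι → Set α}
    (hS : (t : Set ι).PairwiseDisjoint S) {c : ι → 𝕜} (hc : ∀ i, ‖c i‖ ≤ 1) :
    ‖∑ i ∈ t, c i • lpIndicator 𝕜 (S i)‖ ≤ 1 := by
  refine lp.norm_le_of_forall_le zero_le_one fun k => ?_
  rw [lp.coeFn_sum, Finset.sum_apply]
  by_cases h : ∃ i ∈ t, k ∈ S i
  · obtain ⟨i, hi, hk⟩ := h
    rw [Finset.sum_eq_single_of_mem i hi]
    · simpa [hk] using hc i
    · intro j hj hji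
      have : k ∉ S j := fun hkj => Set.disjoint_left.1 (hS hj hi hji) hkj hk
      simp [this]
  · push Not at h
    rw [Finset.sum_eq_zero fun i hi => by simp [h i hi], norm_zero]
    exact zero_le_one

theorem sum_norm_map_lpIndicator_le_of_pairwiseDisjoint (f : lp (fun _ : α => 𝕜) ∞ →L[𝕜] 𝕜)
    {t : Finset ι} {S : ι → Set α} (hS : (t : Set ι).PairwiseDisjoint S) :
    ∑ i ∈ t, ‖f (lpIndicator 𝕜 (S i))‖ ≤ ‖f‖ := by
  choose c hc hcf using fun i => RCLike.exists_norm_eq_mul_self (f (lpIndicator 𝕜 (S i)))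
  have hsum : f (∑ i ∈ t, c i • lpIndicator 𝕜 (S i)) =
      ((∑ i ∈ t, ‖f (lpIndicator 𝕜 (S i))‖ : ℝ) : 𝕜) := by
    simp only [map_sum, map_smul, smul_eq_mul, hcf]
  calc ∑ i ∈ t, ‖f (lpIndicator 𝕜 (S i))‖
      = ‖f (∑ i ∈ t, c i • lpIndicator 𝕜 (S i))‖ := by
        rw [hsum, RCLike.norm_ofReal, abs_of_nonneg (Finset.sum_nonneg fun _ _ => norm_nonneg _)]
    _ ≤ ‖f‖ := f.unit_le_opNorm _ (norm_sum_smul_lpIndicator_le_one hS fun i => (hc i).le)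

variable [DecidableEq α] {f : lp (fun _ : α => 𝕜) ∞ →L[𝕜] 𝕜}

theorem map_lpIndicator_eq_zero_of_finite (hf : ∀ n, f (lp.single ∞ n 1) = 0) {F : Set α}
    (hF : F.Finite) : f (lpIndicator 𝕜 F) = 0 := by
  have : lpIndicator 𝕜 F = ∑ n ∈ hF.toFinset, lp.single ∞ n 1 := by
    ext k
    rw [lp.coeFn_sum, Finset.sum_apply]
    by_cases hk : k ∈ F <;> simp [hk, Pi.single_apply]
  rw [this, map_sum]
  exact Finset.sum_eq_zero fun n _ => hf n

theorem map_lpIndicator_diff (hf : ∀ n, f (lp.single ∞ n 1) = 0) (S : Set α) {F : Set α}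
    (hF : F.Finite) : f (lpIndicator 𝕜 (S \ F)) = f (lpIndicator 𝕜 S) := by
  have : lpIndicator 𝕜 S = lpIndicator 𝕜 (S \ F) + lpIndicator 𝕜 (S ∩ F) := by
    ext k
    by_cases hS : k ∈ S <;> by_cases hkF : k ∈ F <;> simp [hS, hkF]
  rw [this, map_add, map_lpIndicator_eq_zero_of_finite hf (hF.inter_of_right S), add_zero]

theorem sum_norm_map_lpIndicator_le (hf : ∀ n, f (lp.single ∞ n 1) = 0) {S : ι → Set α}
    (hS : Pairwise fun i j => (S i ∩ S j).Finite) (t : Finset ι) :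
    ∑ i ∈ t, ‖f (lpIndicator 𝕜 (S i))‖ ≤ ‖f‖ := by
  classical
  let F : Set α := ⋃ p ∈ t.offDiag, S p.1 ∩ S p.2
  have hF : F.Finite := t.offDiag.finite_toSet.biUnion fun p hp =>
    hS (Finset.mem_offDiag.1 (Finset.mem_coe.1 hp)).2.2
  have hdisj : (t : Set ι).PairwiseDisjoint fun i => S i \ F := by
    intro i hi j hj hij
    refine Set.disjoint_left.2 fun k hki hkj => hki.2 ?_
    exact Set.mem_biUnion (x := (i, j)) (Finset.mem_offDiag.2 ⟨hi, hj, hij⟩) ⟨hki.1, hkj.1⟩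
  simpa only [map_lpIndicator_diff hf _ hF] using
    sum_norm_map_lpIndicator_le_of_pairwiseDisjoint f hdisj

theorem countable_map_lpIndicator_ne_zero (hf : ∀ n, f (lp.single ∞ n 1) = 0) {S : ι → Set α}
    (hS : Pairwise fun i j => (S i ∩ S j).Finite) :
    {i | f (lpIndicator 𝕜 (S i)) ≠ 0}.Countable := by
  have hsum : Summable fun i => ‖f (lpIndicator 𝕜 (S i))‖ :=
    summable_of_sum_le (fun _ => norm_nonneg _) (sum_norm_map_lpIndicator_le hf hS)
  simpa [Function.support] using hsum.countable_support

theorem not_isSeparable_common_ker [Countable ι] {f : ι → lp (fun _ : ℕ => 𝕜) ∞ →L[𝕜] 𝕜}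
    (hf : ∀ i n, f i (lp.single ∞ n 1) = 0) : ¬ IsSeparable {x | ∀ i, f i x = 0} := by
  intro hsep
  obtain ⟨S, hSinj, hSfin⟩ := exists_almost_disjoint_family
  let G : Set (ℕ → Bool) := {g | ∀ i, f i (lpIndicator 𝕜 (S g)) = 0}
  have hGcompl : Gᶜ.Countable := by
    have : Gᶜ = ⋃ i, {g | f i (lpIndicator 𝕜 (S g)) ≠ 0} := by
      ext g
      simp [G]
    rw [this]
    exact Set.countable_iUnion fun i => countable_map_lpIndicator_ne_zero (hf i) hSfin
  have hG : G.Countable := countable_of_isSeparable_of_pairwise_le_dist hsep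
    (fun g : G => lpIndicator 𝕜 (S g)) (fun g => g.2) one_pos
    fun g h hgh => one_le_dist_lpIndicator fun e => hgh (Subtype.ext (hSinj e))
  have huniv : (Set.univ : Set (ℕ → Bool)).Countable := by
    rw [← Set.union_compl_self G]
    exact hG.union hGcompl
  rw [← Cardinal.le_aleph0_iff_set_countable, Cardinal.mk_univ] at huniv
  exact Cardinal.aleph0_lt_continuum.not_ge (by simpa using huniv)

end Indicator

section Blocks

variable {α ι 𝕜 : Type*}

theorem exists_linearIsometry_of_disjoint_support [DecidableEq ι] [Nonempty ι] [RCLike 𝕜]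
    {u : ι → lp (fun _ : α => 𝕜) ∞} (hu : ∀ i, ‖u i‖ = 1)
    (hdisj : Pairwise fun i j => Disjoint (support (u i)) (support (u j))) :
    ∃ J : lp (fun _ : ι => 𝕜) ∞ →ₗᵢ[𝕜] lp (fun _ : α => 𝕜) ∞, ∀ i, J (lp.single ∞ i 1) = u i := by
  have exists_index (k : α) : ∃ i, ∀ j, u j k ≠ 0 → i = j := by
    by_cases hk : ∃ i, u i k ≠ 0
    · obtain ⟨i, hi⟩ := hk
      exact ⟨i, fun j hj => by_contra fun hij => Set.disjoint_left.1 (hdisj hij) hi hj⟩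
    · push Not at hk
      exact ⟨Classical.arbitrary ι, fun i hi => absurd (hk i) hi⟩
  choose π hπ using exists_index
  have coord_le (x : lp (fun _ : ι => 𝕜) ∞) (k : α) : ‖x (π k) * u (π k) k‖ ≤ ‖x‖ := by
    rw [norm_mul]
    have hx : ‖x (π k)‖ ≤ ‖x‖ := lp.norm_apply_le_norm ENNReal.top_ne_zero x _
    have huk : ‖u (π k) k‖ ≤ 1 := (lp.norm_apply_le_norm ENNReal.top_ne_zero _ k).trans_eq (hu _)
    exact (mul_le_mul hx huk (norm_nonneg _) (norm_nonneg _)).trans_eq (mul_one _)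
  let J : lp (fun _ : ι => 𝕜) ∞ →ₗ[𝕜] lp (fun _ : α => 𝕜) ∞ :=
    { toFun := fun x => ⟨fun k => x (π k) * u (π k) k,
        memℓp_infty ⟨‖x‖, by rintro _ ⟨k, rfl⟩; exact coord_le x k⟩⟩
      map_add' := fun x y => by ext k; exact add_mul _ _ _
      map_smul' := fun c x => by ext k; exact mul_assoc _ _ _ }
  have norm_coord_le (x : lp (fun _ : ι => 𝕜) ∞) (i : ι) : ‖x i‖ ≤ ‖J x‖ := by
    calc ‖x i‖ = ‖x i • u i‖ := by rw [norm_smul, hu, mul_one]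
      _ ≤ ‖J x‖ := lp.norm_le_of_forall_le (norm_nonneg _) fun k => ?_
    by_cases hk : u i k = 0
    · simp [hk]
    · obtain rfl := hπ k i hk
      exact lp.norm_apply_le_norm ENNReal.top_ne_zero (J x) k
  refine ⟨⟨J, fun x => le_antisymm (lp.norm_le_of_forall_le (norm_nonneg x) (coord_le x))
    (lp.norm_le_of_forall_le (norm_nonneg _) (norm_coord_le x))⟩, fun i => ?_⟩
  ext k
  change (lp.single ∞ i 1 : lp (fun _ : ι => 𝕜) ∞) (π k) * u (π k) k = u i k
  by_cases hk : π k = i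
  · simp [hk]
  · have : u i k = 0 := by_contra fun h => hk (hπ k i h)
    simp [hk, this]

theorem linearIndependent_lp_single [DecidableEq α] [RCLike 𝕜] :
    LinearIndependent 𝕜 fun n : α => (lp.single ∞ n 1 : lp (fun _ : α => 𝕜) ∞) :=
  .of_comp (LinearMap.pi fun k => lp.evalₗ (𝕜 := 𝕜) (fun _ : α => 𝕜) ∞ k)
    (Pi.linearIndependent_single_one α 𝕜)

theorem support_subset_of_mem_span_lp_single [DecidableEq α] [RCLike 𝕜] {t : Set α}
    {v : lp (fun _ : α => 𝕜) ∞}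
    (hv : v ∈ Submodule.span 𝕜 ((fun n : α => lp.single ∞ n (1 : 𝕜)) '' t)) : support v ⊆ t := by
  refine support_subset_iff'.2 fun k hk => ?_
  suffices Submodule.span 𝕜 ((fun n : α => lp.single ∞ n (1 : 𝕜)) '' t) ≤
    LinearMap.ker (lp.evalₗ (𝕜 := 𝕜) (fun _ : α => 𝕜) ∞ k) from this hv
  rw [Submodule.span_le]
  rintro _ ⟨n, hn, rfl⟩
  have hkn : k ≠ n := by
    rintro rfl
    exact hk hn
  exact Pi.single_eq_of_ne hkn 1

variable (B : LinearMap.BilinForm ℂ (lp (fun _ : α => ℂ) ∞))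

theorem exists_isotropic_support_subset (s : Finset (lp (fun _ : α => ℂ) ∞)) {A : Set α}
    (hA : A.Infinite) :
    ∃ v, ‖v‖ = 1 ∧ B v v = 0 ∧ (support v).Finite ∧ support v ⊆ A ∧ ∀ x ∈ s, B x v = 0 := by
  classical
  obtain ⟨t, htA, htcard⟩ := hA.exists_subset_card_eq (s.card + 2)
  let V : Submodule ℂ (lp (fun _ : α => ℂ) ∞) :=
    Submodule.span ℂ ((fun n => lp.single ∞ n (1 : ℂ)) '' t)
  have hV : Module.finrank ℂ V = t.card := by
    rw [← Fintype.card_coe t, ← finrank_span_eq_card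
      ((linearIndependent_lp_single (𝕜 := ℂ)).comp ((↑) : t → α) Subtype.val_injective),
      Set.range_comp, Subtype.range_coe_subtype]
    rfl
  obtain ⟨v, hvV, hv0, hiso, horth⟩ := exists_isotropic_mem_of_card_lt_finrank B s V (by omega)
  have hunit : ((‖v‖ : ℂ)⁻¹ • v) ∈ V := V.smul_mem _ hvV
  have hsupp := support_subset_of_mem_span_lp_single hunit
  refine ⟨(‖v‖ : ℂ)⁻¹ • v, norm_smul_inv_norm hv0, by simp [hiso], t.finite_toSet.subset hsupp,
    hsupp.trans htA, fun x hx => by simp [horth x hx]⟩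

theorem exists_isotropic_block_sequence [Infinite α] (hB : B.IsSymm) :
    ∃ u : ℕ → lp (fun _ : α => ℂ) ∞, (∀ n, ‖u n‖ = 1) ∧ (∀ m n, B (u m) (u n) = 0) ∧
      Pairwise fun m n => Disjoint (support (u m)) (support (u n)) := by
  let r (x y : lp (fun _ : α => ℂ) ∞) : Prop := B x y = 0 ∧ Disjoint (support x) (support y)
  have : Std.Symm r := ⟨fun x y h => ⟨(hB.eq y x).trans h.1, h.2.symm⟩⟩
  obtain ⟨u, hu, hr⟩ := exists_seq_of_forall_finset_exists'
    (fun x : lp (fun _ : α => ℂ) ∞ => (‖x‖ = 1 ∧ B x x = 0) ∧ (support x).Finite) r (by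
      intro s hs
      have hfin : (⋃ x ∈ s, support x).Finite := s.finite_toSet.biUnion fun x hx => (hs x hx).2
      obtain ⟨v, hv1, hv0, hvfin, hvsupp, horth⟩ :=
        exists_isotropic_support_subset B s hfin.infinite_compl
      refine ⟨v, ⟨⟨hv1, hv0⟩, hvfin⟩, fun x hx => ⟨horth x hx, ?_⟩⟩
      refine Set.disjoint_right.2 fun k hkv hkx => hvsupp hkv ?_
      exact Set.mem_biUnion hx hkx)
  refine ⟨u, fun n => (hu n).1.1, fun m n => ?_, fun m n hmn => (hr hmn).2⟩
  obtain rfl | hmn := eq_or_ne m n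
  · exact (hu m).1.2
  · exact (hr hmn).1

theorem exists_linearIsometry_isotropic [Infinite α] (hB : B.IsSymm) :
    ∃ J : lp (fun _ : ℕ => ℂ) ∞ →ₗᵢ[ℂ] lp (fun _ : α => ℂ) ∞,
      ∀ m n, B (J (lp.single ∞ m 1)) (J (lp.single ∞ n 1)) = 0 := by
  obtain ⟨u, hu, hBu, hdisj⟩ := exists_isotropic_block_sequence B hB
  obtain ⟨J, hJ⟩ := exists_linearIsometry_of_disjoint_support hu hdisj
  exact ⟨J, fun m n => by rw [hJ, hJ, hBu]⟩

end Blocks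

theorem IsTotallyIsotropic.isPMaximal_of_maximal {𝕜 X : Type*} [RCLike 𝕜]
    [NormedAddCommGroup X] [NormedSpace 𝕜 X] {P : X → 𝕜} {B : LinearMap.BilinForm 𝕜 X}
    (hPB : ∀ x, P x = B x x) (hP : P ≠ 0) {M : Submodule 𝕜 X}
    (hM : Maximal (IsTotallyIsotropic B) M) : IsPMaximal P M := by
  obtain rfl : P = fun x => B x x := funext hPB
  refine ⟨?_, hM.prop, fun M₁ hM₁ hle => (hM.eq_of_le hM₁ hle).symm⟩
  rintro rfl
  exact hP (funext fun x => hM.prop x Submodule.mem_top)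

theorem not_separableSpace_of_maximal {X : Type*} [NormedAddCommGroup X] [NormedSpace ℂ X]
    {B : LinearMap.BilinForm ℂ X} (hB : B.IsSymm) (hBc : ∀ x, Continuous (B x))
    {M : Submodule ℂ X} (hM : Maximal (IsTotallyIsotropic B) M)
    {T : lp (fun _ : ℕ => ℂ) ∞ →L[ℂ] X} (hT : Topology.IsInducing T)
    (hTM : ∀ n, T (lp.single ∞ n 1) ∈ M) : ¬ SeparableSpace M := by
  intro hsep
  let f (i : ℕ) : lp (fun _ : ℕ => ℂ) ∞ →L[ℂ] ℂ := ⟨B (denseSeq M i), hBc _⟩ ∘L T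
  have hf (i n : ℕ) : f i (lp.single ∞ n 1) = 0 :=
    hM.prop.apply_eq_zero hB (denseSeq M i).2 (hTM n)
  have horth : IsSeparable (B.orthogonal M : Set X) :=
    isSeparable_orthogonal_of_maximal hB hM (.of_subtype (M : Set X))
  refine not_isSeparable_common_ker hf ((hT.isSeparable_preimage horth).mono fun x hx m hm => ?_)
  have hclosed : IsClosed {d : M | B d (T x) = 0} := by
    simp only [hB.eq _ (T x)]
    exact isClosed_eq ((hBc _).comp continuous_subtype_val) continuous_const
  exact isClosed_property (denseRange_denseSeq M) hclosed hx ⟨m, hm⟩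

theorem theorem20_general {X : Type*} [NormedAddCommGroup X] [NormedSpace ℂ X]
    {T : lp (fun _ : ℕ => ℂ) ∞ →L[ℂ] X} (hT : Topology.IsInducing T) {P : X → ℂ}
    (hP : IsContHomogeneousPolynomial (𝕜 := ℂ) 2 P) (hP0 : P ≠ 0) :
    ∃ M : Submodule ℂ X, IsPMaximal P M ∧ ¬ SeparableSpace M := by
  obtain ⟨B, hB, hBc, hPB⟩ := hP.exists_bilinForm
  obtain ⟨J, hJ⟩ := exists_linearIsometry_isotropic (B.compl₁₂ T.toLinearMap T.toLinearMap)
    ⟨fun x y => hB.eq (T x) (T y)⟩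
  have hspan : IsTotallyIsotropic B
      (Submodule.span ℂ (Set.range fun n => T (J (lp.single ∞ n 1)))) :=
    .span (by rintro _ ⟨m, rfl⟩ _ ⟨n, rfl⟩; exact hJ m n)
  obtain ⟨M, hle, hM⟩ := hspan.exists_le_maximal
  refine ⟨M, IsTotallyIsotropic.isPMaximal_of_maximal hPB hP0 hM, ?_⟩
  exact not_separableSpace_of_maximal hB hBc hM
    (T := T ∘L J.toContinuousLinearMap) (hT.comp J.isometry.isUniformInducing.isInducing)
    fun n => hle (Submodule.subset_span ⟨n, rfl⟩)

theorem theorem20 (P : lp (fun _ : ℕ => ℂ) ∞ → ℂ)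
    (hP : IsContHomogeneousPolynomial (𝕜 := ℂ) 2 P) (hP0 : P ≠ 0) :
    ∃ M : Submodule ℂ (lp (fun _ : ℕ => ℂ) ∞),
      IsPMaximal P M ∧ ¬ TopologicalSpace.SeparableSpace M :=
  theorem20_general (T := .id ℂ _) .id hP hP0
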